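/- Let $\mathcal A$ be a complex Banach algebra (not necessarily unital or commutative), and let $L^1(\mathbb R_+)$ be the space of (classes of) complex-valued Lebesgue integrable functions on $\mathbb R_+=[0,\infty)$ with the convolution product $(f*g)(t)=\int_0^t f(t-s)g(s)\,ds$. Let $T:L^1(\mathbb R_+)\to\mathcal A$ be an algebra homomorphism, i.e. $T$ is linear and $T(f*g)=T(f)\,T(g)$ for all $f,g\in L^1(\mathbb R_+)$. Then the following are equivalent: 1. $T$ is (Riesz) representable, i.e. there exists $f\in L^\infty(\mathbb R_+;\mathcal A)$ such that $Tg=\int_{\mathbb R_+} g(s)f(s)\,ds$ for every $g\in L^1(\mathbb R_+)$; 2. there exists a family $(a(t))_{t>0}\subset\mathcal A$ which is a semigroup ($a(s+t)=a(s)a(t)$ for all $s,t>0$), is uniformly bounded ($\sup_{t>0}\|a(t)\|<\infty$) and is norm-continuous on $(0,\infty)$ (no continuity condition at $0$), such that $Tg=\int_0^\infty a(t)g(t)\,dt$ for every $g\in L^1(\mathbb R_+)$. The integrals are Bochner integrals in $\mathcal A$, and $L^\infty(\mathbb R_+;\mathcal A)$ consists of (classes of) strongly measurable, essentially bounded functions.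 -/

import Mathlib

open MeasureTheory Set
open scoped ENNReal

/-- Lebesgue measure on the half-line `ℝ₊` (the end point `0` is a null set). -/
noncomputable abbrev halfLineMeasure : Measure ℝ := volume.restrict (Ioi (0 : ℝ))

/-- The complex Banach space `L¹(ℝ₊)`. -/
abbrev L1HalfLine : Type := Lp ℂ 1 halfLineMeasure

/-- The convolution `(f * g)(t) = ∫₀ᵗ f(t - s) g(s) ds` of functions on the half-line. -/
noncomputable def halfLineConv (f g : ℝ → ℂ) (t : ℝ) : ℂ :=
  ∫ s in (0 : ℝ)..t, f (t - s) * g s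

theorem memLp_halfLineConv (f g : L1HalfLine) :
    MemLp (halfLineConv f g) 1 halfLineMeasure := by
  rw [memLp_one_iff_integrable]
  have hf : Integrable f halfLineMeasure := L1.integrable_coeFn f
  have hg : Integrable g halfLineMeasure := L1.integrable_coeFn g
  have h := (integrable_posConvolution hg hf (ContinuousLinearMap.mul ℝ ℂ)).integrableOn
    (s := Ioi (0 : ℝ))
  refine h.congr ?_
  filter_upwards [ae_restrict_mem measurableSet_Ioi] with t ht
  simp only [posConvolution, indicator_of_mem ht, halfLineConv, ContinuousLinearMap.mul_apply']
  simp only [mul_comm]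

/-- The convolution product of `L¹(ℝ₊)`. -/
noncomputable def L1HalfLine.conv (f g : L1HalfLine) : L1HalfLine :=
  (memLp_halfLineConv f g).toLp (halfLineConv f g)

/-- `T : L¹(ℝ₊) → 𝒜` is an algebra homomorphism: it is linear (as a bundled linear map) and
turns convolution into the product of `𝒜`. No continuity of `T` is assumed. -/
def IsL1AlgebraHom {A : Type*} [NonUnitalNormedRing A] [NormedSpace ℂ A]
    (T : L1HalfLine →ₗ[ℂ] A) : Prop :=
  ∀ f g : L1HalfLine, T (L1HalfLine.conv f g) = T f * T g

/-- `T : L¹(ℝ₊) → X` is (Riesz) representable: there is `f ∈ L^∞(ℝ₊; X)` with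
`T g = ∫ g(s) f(s) ds` (Bochner integral) for all `g ∈ L¹(ℝ₊)`. The integrand is always
integrable, and such a `T` is automatically bounded. -/
def IsRieszRepresentable {X : Type*} [NormedAddCommGroup X] [NormedSpace ℂ X]
    (T : L1HalfLine →ₗ[ℂ] X) : Prop :=
  ∃ f : Lp X ∞ halfLineMeasure, ∀ g : L1HalfLine, T g = ∫ s in Ioi (0 : ℝ), g s • f s

/-- `(a(t))_{t > 0}` is a uniformly bounded, norm-continuous semigroup in `A`; values of `a`
outside `(0, ∞)` are irrelevant and nothing is required at `0`. -/
structure IsBoundedContinuousSemigroup {A : Type*} [NonUnitalNormedRing A] (a : ℝ → A) :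
    Prop where
  map_add : ∀ s t : ℝ, 0 < s → 0 < t → a (s + t) = a s * a t
  bounded : ∃ C : ℝ, ∀ t : ℝ, 0 < t → ‖a t‖ ≤ C
  continuousOn : ContinuousOn a (Ioi (0 : ℝ))

/-! A representing function `f` inherits the product rule of `T`: by Fubini, testing on rectangles
gives f(s + t) = f(t) f(s) for almost every (s, t) (`IsL1AlgebraHom.ae_map_add`). Integrating f(s)
f(t - s) = f(t) over 0 < s < t gives t f(t) = (f * f)(t) for almost every t. The right side is
continuous, so dividing by t yields a continuous representative on (0, ∞), for which the semigroup
law holds everywhere. Nothing controls the quotient's continuity at 0. Conversely, a bounded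
continuous `a` defines a class in L^∞. -/

open Filter Topology
open scoped Convolution

section PiSystem

variable {α β E : Type*} [MeasurableSpace α] [MeasurableSpace β] [NormedAddCommGroup E]
  [NormedSpace ℝ E] [CompleteSpace E]

/-- An integrable function on a product whose integral over every measurable rectangle vanishes
is zero almost everywhere. -/
theorem ae_eq_zero_of_forall_setIntegral_rectangle {μ : Measure α} {ν : Measure β}
    {f : α × β → E} (hf : Integrable f (μ.prod ν))
    (h : ∀ s t, MeasurableSet s → MeasurableSet t → ∫ z in s ×ˢ t, f z ∂μ.prod ν = 0) :
    f =ᵐ[μ.prod ν] 0 := by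
  refine hf.ae_eq_zero_of_forall_setIntegral_eq_zero fun s hs hfin => ?_
  clear hfin
  -- Needed for complements in the π-λ induction.
  have huniv : ∫ z, f z ∂μ.prod ν = 0 := by
    simpa using h univ univ .univ .univ
  induction s, hs using MeasurableSpace.induction_on_inter generateFrom_prod.symm
    isPiSystem_prod with
  | empty => simp
  | basic u hu =>
    obtain ⟨s, hs, t, ht, rfl⟩ := hu
    exact h s t hs ht
  | compl u hu ih =>
    have := integral_add_compl hu hf
    rw [huniv] at this
    simpa [ih] using this
  | iUnion u hd hu ih =>
    rw [integral_iUnion hu hd hf.integrableOn]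
    simp [ih]

end PiSystem

section Convolution

variable {A : Type*} [NonUnitalNormedRing A] [NormedSpace ℂ A] [IsScalarTower ℂ A A]
  [SMulCommClass ℂ A A]

/-- The convolution of a bounded function with an integrable one is continuous. -/
theorem continuous_integral_mul_sub {f g : ℝ → A} {C : ℝ} (hf : Integrable f)
    (hC : ∀ x, ‖f x‖ ≤ C) (hg : Integrable g) :
    Continuous fun t => ∫ s, f s * g (t - s) := by
  have hC0 : 0 ≤ C := (norm_nonneg _).trans (hC 0)
  -- Replacing `g` by a compactly supported continuous function close in L¹ changes the convolution
  -- by at most `C` times the L¹ distance, uniformly in `t`.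
  have key : ∀ n : ℕ, ∃ k : ℝ → A, Continuous k ∧
      ∀ t, ‖(∫ s, f s * g (t - s)) - k t‖ ≤ C * (1 / ((n : ℝ) + 1)) := by
    intro n
    obtain ⟨k, hk, hdist, hcont, hint⟩ := hg.exists_hasCompactSupport_integral_sub_le
      (ε := 1 / ((n : ℝ) + 1)) (by positivity)
    refine ⟨_, (hcont.norm.bddAbove_range_of_hasCompactSupport
      hk.norm).continuous_convolution_right_of_integrable (ContinuousLinearMap.mul ℂ A) hf hcont,
      fun t => ?_⟩
    have hmul : ∀ {u : ℝ → A}, Integrable u → Integrable fun s => f s * u (t - s) := fun hu =>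
      ((hu.comp_sub_left t).norm.const_mul C).mono'
        (hf.aestronglyMeasurable.mul (hu.comp_sub_left t).aestronglyMeasurable)
        (.of_forall fun s => (norm_mul_le _ _).trans (by gcongr; exact hC s))
    have hsub : Integrable fun s => ‖g s - k s‖ := (hg.sub hint).norm
    simp only [convolution, ContinuousLinearMap.mul_apply']
    rw [← integral_sub (hmul hg) (hmul hint)]
    calc ‖∫ s, (f s * g (t - s) - f s * k (t - s))‖
        ≤ ∫ s, C * ‖g (t - s) - k (t - s)‖ := by
          refine norm_integral_le_of_norm_le ((hsub.comp_sub_left t).const_mul C)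
            (.of_forall fun s => ?_)
          rw [← mul_sub]
          exact (norm_mul_le _ _).trans (by gcongr; exact hC s)
      _ = C * ∫ s, ‖g s - k s‖ := by
          rw [integral_const_mul, integral_sub_left_eq_self (fun s => ‖g s - k s‖)]
      _ ≤ _ := by gcongr
  choose k hk hle using key
  have hlim : Tendsto (fun n : ℕ => C * (1 / ((n : ℝ) + 1))) atTop (𝓝 0) := by
    simpa using tendsto_one_div_add_atTop_nhds_zero_nat.const_mul C
  refine TendstoUniformly.continuous (F := k) (p := atTop) ?_ (.of_forall hk)
  rw [Metric.tendstoUniformly_iff]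
  intro ε hε
  filter_upwards [hlim.eventually (gt_mem_nhds hε)] with n hn t
  rw [dist_eq_norm]
  exact (hle n t).trans_lt hn

end Convolution

/-- Integrating a bounded function against a convolution. -/
theorem integral_convolution_smul {E : Type*} [NormedAddCommGroup E] [NormedSpace ℂ E]
    [CompleteSpace E]
    {g h : ℝ → ℂ} {f : ℝ → E} {C : ℝ} (hg : Integrable g) (hh : Integrable h)
    (hf : StronglyMeasurable f) (hC : ∀ x, ‖f x‖ ≤ C) :
    ∫ r, (∫ s, h s * g (r - s)) • f r = ∫ z : ℝ × ℝ, (h z.1 * g z.2) • f (z.1 + z.2) := by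
  have hint : Integrable (fun p : ℝ × ℝ => (h p.2 * g (p.1 - p.2)) • f p.1) := by
    refine Integrable.smul_bdd (hh.convolution_integrand (ContinuousLinearMap.mul ℝ ℂ) hg) C
      (hf.comp_measurable measurable_fst).aestronglyMeasurable (.of_forall fun z => hC z.1)
  -- The shear (s, t) ↦ (s, s + t) turns r - s into an independent variable.
  have hmp := measurePreserving_prod_add (volume : Measure ℝ) (volume : Measure ℝ)
  have hswap := hint.swap
  calc ∫ r, (∫ s, h s * g (r - s)) • f r
      = ∫ r, ∫ s, (h s * g (r - s)) • f r := by simp only [integral_smul_const]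
    _ = ∫ z : ℝ × ℝ, (h z.1 * g (z.2 - z.1)) • f z.2 := (integral_prod_symm _ hswap).symm
    _ = ∫ z, (h z.1 * g (z.2 - z.1)) • f z.2
          ∂(Measure.map (fun z : ℝ × ℝ => (z.1, z.1 + z.2)) (volume.prod volume)) := by
        rw [hmp.map_eq]; rfl
    _ = _ := by
        rw [integral_map hmp.measurable.aemeasurable (by rw [hmp.map_eq]; exact hswap.1)]
        simp [Measure.volume_eq_prod]

theorem halfLineConv_eq_integral_indicator (g h : ℝ → ℂ) {t : ℝ} (ht : 0 < t) :
    halfLineConv g h t =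
      ∫ s, (Ioi (0 : ℝ)).indicator h s * (Ioi (0 : ℝ)).indicator g (t - s) := by
  have := congrFun (posConvolution_eq_convolution_indicator h g
    (ContinuousLinearMap.mul ℝ ℂ) volume) t
  simp only [posConvolution, indicator_of_mem (mem_Ioi.2 ht), convolution,
    ContinuousLinearMap.mul_apply'] at this
  rw [← this]
  simp only [halfLineConv, mul_comm]

/-- Extension by zero reduces this to the whole line; `hf0` removes the constraint on `r`. -/
theorem setIntegral_halfLineConv_smul {E : Type*} [NormedAddCommGroup E] [NormedSpace ℂ E]
    [CompleteSpace E]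
    {g h : ℝ → ℂ} {f : ℝ → E} {C : ℝ} (hg : Integrable g halfLineMeasure)
    (hh : Integrable h halfLineMeasure) (hf : StronglyMeasurable f) (hC : ∀ x, ‖f x‖ ≤ C)
    (hf0 : ∀ x ≤ 0, f x = 0) :
    ∫ r in Ioi (0 : ℝ), halfLineConv g h r • f r =
      ∫ z, (h z.1 * g z.2) • f (z.1 + z.2) ∂(halfLineMeasure.prod halfLineMeasure) := by
  have hg' := (integrable_indicator_iff measurableSet_Ioi).2 hg
  have hh' := (integrable_indicator_iff measurableSet_Ioi).2 hh
  calc ∫ r in Ioi (0 : ℝ), halfLineConv g h r • f r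
      = ∫ r in Ioi (0 : ℝ),
          (∫ s, (Ioi (0 : ℝ)).indicator h s * (Ioi (0 : ℝ)).indicator g (r - s)) • f r :=
        setIntegral_congr_fun measurableSet_Ioi fun r hr => by
          simp only [halfLineConv_eq_integral_indicator g h hr]
    _ = ∫ r, (∫ s, (Ioi (0 : ℝ)).indicator h s * (Ioi (0 : ℝ)).indicator g (r - s)) • f r :=
        setIntegral_eq_integral_of_forall_compl_eq_zero fun r hr => by
          rw [hf0 r (not_lt.1 hr), smul_zero]
    _ = _ := integral_convolution_smul hg' hh' hf hC
    _ = _ := by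
        rw [Measure.prod_restrict, ← integral_indicator (measurableSet_Ioi.prod measurableSet_Ioi)]
        refine integral_congr_ae (.of_forall fun z => ?_)
        by_cases h1 : 0 < z.1 <;> by_cases h2 : 0 < z.2 <;> simp [indicator, h1, h2]

/-- A representing function can be chosen everywhere bounded, and zero off the half-line. -/
theorem IsRieszRepresentable.exists_bounded {X : Type*} [NormedAddCommGroup X] [NormedSpace ℂ X]
    {T : L1HalfLine →ₗ[ℂ] X} (hT : IsRieszRepresentable T) :
    ∃ (f : ℝ → X) (C : ℝ), StronglyMeasurable f ∧ (∀ x, ‖f x‖ ≤ C) ∧ (∀ x ≤ 0, f x = 0) ∧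
      ∀ g : L1HalfLine, T g = ∫ s in Ioi (0 : ℝ), g s • f s := by
  obtain ⟨f, hf⟩ := hT
  have hsm : StronglyMeasurable f := Lp.stronglyMeasurable f
  have hbdd : ∀ᵐ x ∂halfLineMeasure, ‖f x‖ ≤ ‖f‖ := by
    filter_upwards [enorm_ae_le_eLpNormEssSup f halfLineMeasure] with x hx
    rw [Lp.norm_def, eLpNorm_exponent_top, ← toReal_enorm]
    exact ENNReal.toReal_mono (by simpa using (Lp.memLp f).eLpNorm_ne_top) hx
  have hmeas : MeasurableSet (Ioi (0 : ℝ) ∩ {x | ‖f x‖ ≤ ‖f‖}) :=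
    measurableSet_Ioi.inter (measurableSet_le hsm.norm.measurable measurable_const)
  refine ⟨indicator (Ioi 0 ∩ {x | ‖f x‖ ≤ ‖f‖}) f, ‖f‖, hsm.indicator hmeas, fun x => ?_,
    fun x hx => ?_, fun g => ?_⟩
  · by_cases hx : x ∈ Ioi (0 : ℝ) ∩ {x | ‖f x‖ ≤ ‖f‖}
    · rw [indicator_of_mem hx]; exact hx.2
    · simp [indicator_of_notMem hx]
  · exact indicator_of_notMem (fun h => (not_lt.2 hx) h.1) _
  · rw [hf g]
    refine integral_congr_ae ?_
    filter_upwards [hbdd, ae_restrict_mem measurableSet_Ioi] with x hx hx0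
    rw [indicator_of_mem (show x ∈ Ioi (0 : ℝ) ∩ {x | ‖f x‖ ≤ ‖f‖} from ⟨hx0, hx⟩)]

/-- This weight makes bounded functions integrable; being multiplicative and nonzero, it cancels
from the semigroup identity. -/
theorem integrable_exp_neg_halfLine :
    Integrable (fun s : ℝ => Complex.exp (-s)) halfLineMeasure := by
  refine (integrable_norm_iff (by fun_prop)).1 ?_
  simpa [Complex.norm_exp, IntegrableOn] using integrableOn_exp_neg_Ioi 0

theorem apply_toLp_eq_setIntegral {X : Type*} [NormedAddCommGroup X] [NormedSpace ℂ X]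
    {T : L1HalfLine →ₗ[ℂ] X} {f : ℝ → X}
    (hT : ∀ g : L1HalfLine, T g = ∫ s in Ioi (0 : ℝ), g s • f s) {g : ℝ → ℂ}
    (hg : MemLp g 1 halfLineMeasure) : T (hg.toLp g) = ∫ s in Ioi (0 : ℝ), g s • f s := by
  rw [hT]
  refine integral_congr_ae ?_
  filter_upwards [hg.coeFn_toLp] with x hx
  rw [hx]

section Semigroup

variable {A : Type*} [NonUnitalNormedRing A] [NormedSpace ℂ A] [IsScalarTower ℂ A A]
  [SMulCommClass ℂ A A] [CompleteSpace A]

/-- The representing function of an algebra homomorphism is multiplicative almost everywhere. -/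
theorem IsL1AlgebraHom.ae_map_add {T : L1HalfLine →ₗ[ℂ] A} (hT : IsL1AlgebraHom T)
    {f : ℝ → A} {C : ℝ} (hf : StronglyMeasurable f) (hC : ∀ x, ‖f x‖ ≤ C)
    (hf0 : ∀ x ≤ 0, f x = 0) (hTf : ∀ g : L1HalfLine, T g = ∫ s in Ioi (0 : ℝ), g s • f s) :
    ∀ᵐ z ∂(halfLineMeasure.prod halfLineMeasure), f (z.1 + z.2) = f z.2 * f z.1 := by
  set e : ℝ → ℂ := fun s => Complex.exp (-s) with he
  have hei : Integrable e halfLineMeasure := integrable_exp_neg_halfLine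
  have hefi : Integrable (fun s => e s • f s) halfLineMeasure :=
    hei.smul_bdd C hf.aestronglyMeasurable (.of_forall hC)
  set P : ℝ × ℝ → A := fun z => (e z.1 * e z.2) • f (z.1 + z.2) with hP
  set Q : ℝ × ℝ → A := fun z => (e z.2 • f z.2) * (e z.1 • f z.1) with hQ
  have hPi : Integrable P (halfLineMeasure.prod halfLineMeasure) :=
    (hei.mul_prod hei).smul_bdd C
      (hf.comp_measurable (measurable_fst.add measurable_snd)).aestronglyMeasurable
      (.of_forall fun z => hC _)
  have hQi : Integrable Q (halfLineMeasure.prod halfLineMeasure) := by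
    refine Integrable.op_fst_snd (op := fun x y : A => y * x) (by fun_prop) ⟨1, fun x y => ?_⟩
      hefi hefi
    rw [one_mul, mul_comm ‖x‖]
    exact norm_mul_le _ _
  have hind : ∀ s : Set ℝ, MeasurableSet s → MemLp (s.indicator e) 1 halfLineMeasure :=
    fun s hs => memLp_one_iff_integrable.2 (hei.indicator hs)
  have hTind : ∀ s (hs : MeasurableSet s), T ((hind s hs).toLp _) =
      ∫ x in s, e x • f x ∂halfLineMeasure := by
    intro s hs
    rw [apply_toLp_eq_setIntegral hTf, ← integral_indicator hs]
    simp only [indicator_smul_apply_left]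
  -- Over `s ×ˢ t`, both integrals equal the product of the values of `T` at the weighted indicators
  -- of `t` and `s`, in that order.
  have key : P - Q =ᵐ[halfLineMeasure.prod halfLineMeasure] 0 := by
    refine ae_eq_zero_of_forall_setIntegral_rectangle (hPi.sub hQi) fun s t hs ht => ?_
    simp only [Pi.sub_apply]
    rw [integral_sub hPi.integrableOn hQi.integrableOn, sub_eq_zero]
    have h1 : ∫ z in s ×ˢ t, Q z ∂(halfLineMeasure.prod halfLineMeasure) =
        T ((hind t ht).toLp _) * T ((hind s hs).toLp _) := by
      rw [hTind t ht, hTind s hs, ← Measure.prod_restrict]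
      exact integral_prod_bilin (ContinuousLinearMap.mul ℂ A).flip hefi.integrableOn
        hefi.integrableOn
    have hg := (hind t ht).coeFn_toLp
    have hh := (hind s hs).coeFn_toLp
    rw [h1, ← hT, L1HalfLine.conv, apply_toLp_eq_setIntegral hTf,
      setIntegral_halfLineConv_smul (L1.integrable_coeFn _) (L1.integrable_coeFn _) hf hC hf0,
      ← integral_indicator (hs.prod ht)]
    refine integral_congr_ae ?_
    filter_upwards [Measure.quasiMeasurePreserving_fst.ae hh,
      Measure.quasiMeasurePreserving_snd.ae hg] with z hz1 hz2
    rw [hz1, hz2]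
    by_cases h1 : z.1 ∈ s <;> by_cases h2 : z.2 ∈ t <;> simp [indicator, h1, h2, hP]
  filter_upwards [key] with z hz
  simp only [Pi.sub_apply, Pi.zero_apply, sub_eq_zero, hP, hQ] at hz
  rw [smul_mul_smul_comm, mul_comm (e z.2)] at hz
  exact smul_right_injective A (mul_ne_zero (Complex.exp_ne_zero _) (Complex.exp_ne_zero _)) hz

/-- A bounded strongly measurable function on the half-line which is multiplicative almost
everywhere agrees almost everywhere with a bounded continuous semigroup. -/
theorem exists_isBoundedContinuousSemigroup_ae_eq {f : ℝ → A} {C : ℝ}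
    (hf : StronglyMeasurable f) (hC : ∀ x, ‖f x‖ ≤ C) (hf0 : ∀ x ≤ 0, f x = 0)
    (hmul : ∀ᵐ z ∂(halfLineMeasure.prod halfLineMeasure), f (z.1 + z.2) = f z.2 * f z.1) :
    ∃ a : ℝ → A, IsBoundedContinuousSemigroup a ∧ a =ᵐ[halfLineMeasure] f := by
  have hC0 : 0 ≤ C := (norm_nonneg _).trans (hC 0)
  set e : ℝ → ℂ := fun s => Complex.exp (-s) with he
  have hene : ∀ t, e t ≠ 0 := fun t => Complex.exp_ne_zero _
  have headd : ∀ t s, e s * e (t - s) = e t := fun t s => by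
    simp only [he, ← Complex.exp_add]; congr 1; push_cast; ring
  have henorm : ∀ t, ‖e t‖ = Real.exp (-t) := fun t => by simp [he, Complex.norm_exp]
  set w : ℝ → A := fun s => e s • f s with hw
  have hw0 : ∀ s ≤ 0, w s = 0 := fun s hs => by simp [hw, hf0 s hs]
  have hwi : Integrable w := by
    have : IntegrableOn w (Ioi 0) := integrable_exp_neg_halfLine.smul_bdd C
      hf.aestronglyMeasurable (.of_forall hC)
    refine (integrableOn_iff_integrable_of_support_subset fun s hs => ?_).1 this
    by_contra h
    exact hs (hw0 s (not_lt.1 h))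
  have hwC : ∀ s, ‖w s‖ ≤ C := fun s => by
    rcases le_or_gt s 0 with hs | hs
    · simpa [hw0 s hs] using hC0
    · rw [hw, norm_smul, henorm]
      exact (mul_le_of_le_one_left (norm_nonneg _) (by simpa using hs.le)).trans (hC s)
  -- The weighted form of f * f: almost everywhere on the half-line it equals t e(t) f(t), hence the
  -- normalization of `a`.
  set b : ℝ → A := fun t => ∫ s, w s * w (t - s) with hb
  have hbc : Continuous b := continuous_integral_mul_sub hwi hwC hwi
  have hprod : ∀ t s, w s * w (t - s) = (Ioo 0 t).indicator (fun s => e t • (f s * f (t - s))) s := by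
    intro t s
    by_cases hs : s ∈ Ioo 0 t
    · simp only [indicator_of_mem hs, hw, smul_mul_smul_comm, headd]
    · rw [indicator_of_notMem hs]
      rcases le_or_gt s 0 with h | h
      · rw [hw0 s h, zero_mul]
      · rw [hw0 (t - s) (by by_contra h'; exact hs ⟨h, by linarith⟩), mul_zero]
  have hbt : ∀ t, b t = ∫ s in Ioo 0 t, e t • (f s * f (t - s)) := fun t => by
    simp only [hb, hprod, integral_indicator measurableSet_Ioo]
  set a : ℝ → A := fun t => ((t : ℂ)⁻¹ * (e t)⁻¹) • b t with ha
  have hac : ContinuousOn a (Ioi 0) := by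
    refine ContinuousOn.smul (ContinuousOn.mul ?_ ?_) hbc.continuousOn
    · exact Complex.continuous_ofReal.continuousOn.inv₀ fun t ht =>
        Complex.ofReal_ne_zero.2 (ne_of_gt ht)
    · exact (Continuous.inv₀ (by fun_prop) hene).continuousOn
  -- Pull `hmul` back along (t, s) ↦ (t - s, s).
  have hconv : ∀ᵐ t, ∀ᵐ s, s ∈ Ioo 0 t → f s * f (t - s) = f t := by
    rw [Measure.prod_restrict, ae_restrict_iff' (measurableSet_Ioi.prod measurableSet_Ioi)] at hmul
    have := (measurePreserving_sub_prod (volume : Measure ℝ)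
      (volume : Measure ℝ)).quasiMeasurePreserving.ae hmul
    filter_upwards [Measure.ae_ae_of_ae_prod this] with t ht
    filter_upwards [ht] with s hs hst
    simpa using (hs ⟨sub_pos.2 hst.2, hst.1⟩).symm
  have haf : a =ᵐ[halfLineMeasure] f := by
    filter_upwards [ae_restrict_of_ae hconv, ae_restrict_mem measurableSet_Ioi] with t ht ht0
    have ht0' : (0 : ℝ) < t := ht0
    have : b t = (t : ℂ) • e t • f t := by
      rw [hbt, setIntegral_congr_ae (g := fun _ => e t • f t) measurableSet_Ioo
        (by filter_upwards [ht] with s hs hst; rw [hs hst])]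
      simp [ht0'.le]
    have hne : (t : ℂ) ≠ 0 := Complex.ofReal_ne_zero.2 ht0'.ne'
    have hone : (t : ℂ)⁻¹ * (e t)⁻¹ * (t * e t) = 1 := by
      have := hene t
      field_simp
    simp only [ha, this, smul_smul, hone, one_smul]
  refine ⟨a, ⟨fun s t hs ht => ?_, ⟨C * C, fun t ht => ?_⟩, hac⟩, haf⟩
  · have hae : ∀ᵐ z ∂(halfLineMeasure.prod halfLineMeasure), a (z.1 + z.2) = a z.2 * a z.1 := by
      have hsum : ∀ᵐ z ∂(halfLineMeasure.prod halfLineMeasure), a (z.1 + z.2) = f (z.1 + z.2) := by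
        rw [Measure.prod_restrict, ae_restrict_iff' (measurableSet_Ioi.prod measurableSet_Ioi)]
        have h := (quasiMeasurePreserving_add (volume : Measure ℝ) (volume : Measure ℝ)).ae
          (ae_imp_of_ae_restrict haf)
        filter_upwards [h] with z hz hz0
        exact hz (mem_Ioi.2 (add_pos hz0.1 hz0.2))
      filter_upwards [hmul, hsum, Measure.quasiMeasurePreserving_fst.ae haf,
        Measure.quasiMeasurePreserving_snd.ae haf] with z h1 h2 h3 h4
      rw [h2, h1, h3, h4]
    rw [Measure.prod_restrict] at hae
    have := Measure.eqOn_open_of_ae_eq hae (isOpen_Ioi.prod isOpen_Ioi)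
      (hac.comp (by fun_prop) fun z hz => mem_Ioi.2 (add_pos hz.1 hz.2))
      ((hac.comp continuousOn_snd fun z hz => hz.2).mul
        (hac.comp continuousOn_fst fun z hz => hz.1))
    simpa [add_comm] using this (show (t, s) ∈ Ioi (0 : ℝ) ×ˢ Ioi (0 : ℝ) from ⟨ht, hs⟩)
  · have hle : ‖b t‖ ≤ ‖e t‖ * (C * C) * t := by
      rw [hbt]
      refine (norm_setIntegral_le_of_norm_le_const (C := ‖e t‖ * (C * C)) (by simp)
        fun s _ => ?_).trans_eq (by simp [ht.le])
      rw [norm_smul]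
      gcongr
      exact (norm_mul_le _ _).trans (mul_le_mul (hC _) (hC _) (norm_nonneg _) hC0)
    have hpos : 0 < ‖e t‖ := norm_pos_iff.2 (hene t)
    rw [ha, norm_smul, norm_mul, norm_inv, norm_inv, Complex.norm_real, Real.norm_of_nonneg ht.le]
    calc t⁻¹ * ‖e t‖⁻¹ * ‖b t‖ ≤ t⁻¹ * ‖e t‖⁻¹ * (‖e t‖ * (C * C) * t) := by gcongr
      _ = C * C := by field_simp

end Semigroup

theorem lemma3p3 {A : Type*} [NonUnitalNormedRing A] [NormedSpace ℂ A]
    [IsScalarTower ℂ A A] [SMulCommClass ℂ A A] [CompleteSpace A]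
    (T : L1HalfLine →ₗ[ℂ] A) (hT : IsL1AlgebraHom T) :
    IsRieszRepresentable T ↔
      ∃ a : ℝ → A, IsBoundedContinuousSemigroup a ∧
        ∀ g : L1HalfLine, T g = ∫ t in Ioi (0 : ℝ), g t • a t := by
  constructor
  · intro hR
    obtain ⟨f, C, hf, hC, hf0, hTf⟩ := hR.exists_bounded
    obtain ⟨a, ha, haf⟩ := exists_isBoundedContinuousSemigroup_ae_eq hf hC hf0
      (hT.ae_map_add hf hC hf0 hTf)
    refine ⟨a, ha, fun g => (hTf g).trans (integral_congr_ae ?_)⟩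
    filter_upwards [haf] with t ht
    rw [ht]
  · rintro ⟨a, ha, hTa⟩
    obtain ⟨C, hC⟩ := ha.bounded
    have hmem : MemLp a ∞ halfLineMeasure := by
      refine memLp_top_of_bound (ha.continuousOn.aestronglyMeasurable measurableSet_Ioi) C ?_
      filter_upwards [ae_restrict_mem measurableSet_Ioi] with t ht
      exact hC t ht
    refine ⟨hmem.toLp a, fun g => (hTa g).trans (integral_congr_ae ?_)⟩
    filter_upwards [hmem.coeFn_toLp] with t ht
    rw [ht]
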